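/- Let $\mathscr A$ be a (not necessarily unital) complex $*$-algebra and let $v,w$ be representable positive functionals on $\mathscr A$: there are Hilbert spaces $H_v,H_w$, $*$-representations $\pi_v:\mathscr A\to\mathscr B(H_v)$, $\pi_w:\mathscr A\to\mathscr B(H_w)$, and vectors $\zeta_v\in H_v$, $\zeta_w\in H_w$ such that $\{\pi_v(a)\zeta_v: a\in\mathscr A\}$ is dense in $H_v$, $\{\pi_w(a)\zeta_w: a\in\mathscr A\}$ is dense in $H_w$, and $v(a)=\langle\pi_v(a)\zeta_v,\zeta_v\rangle$, $w(a)=\langle\pi_w(a)\zeta_w,\zeta_w\rangle$ for all $a\in\mathscr A$ (inner products are linear in the first variable). Fix any such triples. Call $w$ absolutely continuous with respect to $v$ ($v$-absolutely continuous) if for every sequence $(a_n)$ in $\mathscr A$ the conditions $v(a_n^*a_n)\to0$ and $w((a_n^*-a_m^*)(a_n-a_m))\to0$ as $n,m\to\infty$ imply $w(a_n^*a_n)\to0$. Then $w$ is $v$-absolutely continuous if and only if there is a (possibly unbounded, densely defined) positive selfadjoint operator $W$ in $H_v$ such that $\pi_v(a)\zeta_v\in\operatorname{dom}W$ for all $a\in\mathscr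 A$ and $$w(b^*a)=\langle W\pi_v(a)\zeta_v,\,W\pi_v(b)\zeta_v\rangle\qquad(a,b\in\mathscr A).$$ Moreover, $w$ is $v$-absolutely continuous if and only if there is such an operator $W$ which in addition satisfies $\pi_v(a)\xi\in\operatorname{dom}W$ for all $a\in\mathscr A$, $\xi\in\operatorname{dom}W$, and $$\langle W\pi_v(a)\xi,\,W\eta\rangle=\langle W\xi,\,W\pi_v(a^*)\eta\rangle\qquad(a\in\mathscr A,\ \xi,\eta\in\operatorname{dom}W).$$ -/

import Mathlib

open Filter Topology

/-- `(H, π, ζ)` is a cyclic `*`-representation of the (not necessarily unital) `*`-algebra `A`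
by bounded operators on the Hilbert space `H` which represents the linear functional `v`:
`v a = ⟨π a ζ, ζ⟩` (inner product linear in the first variable; Mathlib's `inner ℂ x y` is linear
in the second one), and `{π a ζ | a ∈ A}` is dense in `H`. -/
structure IsRepresentedBy {A : Type*} [NonUnitalRing A] [StarRing A] [Module ℂ A]
    {H : Type*} [NormedAddCommGroup H] [InnerProductSpace ℂ H] [CompleteSpace H]
    (v : A →ₗ[ℂ] ℂ) (π : A →⋆ₙₐ[ℂ] (H →L[ℂ] H)) (ζ : H) : Prop where
  cyclic : Dense (Set.range fun a : A => π a ζ)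
  apply_eq : ∀ a : A, v a = inner ℂ ζ (π a ζ)

/-- `w` is absolutely continuous with respect to `v`: for every sequence `a` in `A`,
`v (aₙ* aₙ) → 0` and `w ((aₙ* - aₘ*) (aₙ - aₘ)) → 0` as `n, m → ∞` imply `w (aₙ* aₙ) → 0`. -/
def IsAbsolutelyContinuous {A : Type*} [NonUnitalRing A] [StarRing A] [Module ℂ A]
    (w v : A →ₗ[ℂ] ℂ) : Prop :=
  ∀ a : ℕ → A,
    Tendsto (fun n => v (star (a n) * a n)) atTop (𝓝 0) →
    Tendsto (fun p : ℕ × ℕ => w ((star (a p.1) - star (a p.2)) * (a p.1 - a p.2)))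
      (atTop ×ˢ atTop) (𝓝 0) →
    Tendsto (fun n => w (star (a n) * a n)) atTop (𝓝 0)

/-- A (possibly unbounded) densely defined operator `W` in a complex Hilbert space is positive and
selfadjoint: `W* = W` and `⟨W ξ, ξ⟩ ≥ 0` for all `ξ ∈ dom W`. -/
structure IsPositiveSelfAdjoint {H : Type*} [NormedAddCommGroup H] [InnerProductSpace ℂ H]
    [CompleteSpace H] (W : H →ₗ.[ℂ] H) : Prop where
  dense_domain : Dense (W.domain : Set H)
  adjoint_eq : W.adjoint = W
  nonneg : ∀ ξ : W.domain, 0 ≤ (inner ℂ (ξ : H) (W ξ)).re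

/-- `π(A)ζ ⊆ dom W` and `w (b* a) = ⟨W π(a) ζ, W π(b) ζ⟩` for all `a, b ∈ A`. -/
def ImplementsForm {A : Type*} [NonUnitalRing A] [StarRing A] [Module ℂ A]
    {H : Type*} [NormedAddCommGroup H] [InnerProductSpace ℂ H] [CompleteSpace H]
    (π : A →⋆ₙₐ[ℂ] (H →L[ℂ] H)) (ζ : H) (w : A →ₗ[ℂ] ℂ) (W : H →ₗ.[ℂ] H) : Prop :=
  ∃ hdom : ∀ a : A, π a ζ ∈ W.domain,
    ∀ a b : A, w (star b * a) = inner ℂ (W ⟨π b ζ, hdom b⟩) (W ⟨π a ζ, hdom a⟩)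

/-- `π(A)ξ ⊆ dom W` for `ξ ∈ dom W`, and `⟨W π(a) ξ, W η⟩ = ⟨W ξ, W π(a*) η⟩` for all `a ∈ A` and
`ξ, η ∈ dom W`. -/
def IntertwinesForm {A : Type*} [NonUnitalRing A] [StarRing A] [Module ℂ A]
    {H : Type*} [NormedAddCommGroup H] [InnerProductSpace ℂ H] [CompleteSpace H]
    (π : A →⋆ₙₐ[ℂ] (H →L[ℂ] H)) (W : H →ₗ.[ℂ] H) : Prop :=
  ∃ hinv : ∀ (a : A) (ξ : W.domain), π a (ξ : H) ∈ W.domain,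
    ∀ (a : A) (ξ η : W.domain),
      inner ℂ (W η) (W ⟨π a (ξ : H), hinv a ξ⟩) =
        inner ℂ (W ⟨π (star a) (η : H), hinv (star a) η⟩) (W ξ)

/-!
Sending `πv a ζv` to `πw a ζw` is a densely defined linear relation from `Hv` to `Hw`, and since
`v (a* a) = ‖πv a ζv‖²` and `w (a* a) = ‖πw a ζw‖²`, absolute continuity of `w` says precisely that
this relation is (the graph of) a closable operator. If `T` is its closure, then `W = |T|` has
`dom W = dom T` and `⟨W ξ, W η⟩ = ⟨T ξ, T η⟩`, which gives the formula for `w`. The graph of `T`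
is invariant under `πv a ⊕ πw a`, so `dom T` is invariant under `πv a` and the intertwining relation
for `W` is the one for the `*`-representation `πw`.

The absolute value of the unbounded operator `T` is obtained without unbounded spectral theory. Let
`D` be the graph of `T`, a Hilbert space, and `P : D → Hv` the first projection, an injective
contraction with dense range. Then `B = P P*` is `(1 + T* T)⁻¹`, and with the bounded operators
`C = B^{1/2}` and `S = (1 - B)^{1/2}`, which commute and satisfy `C² + S² = 1`, the operator
`|T| = (B⁻¹ - 1)^{1/2}` is `S C⁻¹` on `ran C`. Its selfadjointness is elementary algebra
(`isPositiveSelfAdjoint_mulInverse`). Since `‖C x‖ = ‖P* x‖`, the map `C x ↦ P* x` extends to a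
unitary `V : Hv → D` with `C V* = P`; hence `ran C = ran P = dom T`, and
`⟨W P d, W P e⟩ = ⟨d, e⟩ - ⟨P d, P e⟩`
(`exists_isPositiveSelfAdjoint_of_contraction`), which is the inner product of the second
components.

Conversely, if `W` implements `w`, absolute continuity follows because the selfadjoint operator `W`
is closed.
-/

/-! ### Positive selfadjoint operators from bounded ones -/

open ContinuousLinearMap in
theorem exists_commuting_sqrt_pair {H : Type*} [NormedAddCommGroup H] [InnerProductSpace ℂ H]
    [CompleteSpace H] {B : H →L[ℂ] H} (hB : B.IsPositive) (hB' : (1 - B).IsPositive) :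
    ∃ C S : H →L[ℂ] H, IsSelfAdjoint C ∧ IsSelfAdjoint S ∧ Commute C S ∧ (C * S).IsPositive ∧
      C * C = B ∧ C * C + S * S = 1 := by
  rw [← nonneg_iff_isPositive] at hB hB'
  have hcomm : Commute (CFC.sqrt B) (CFC.sqrt (1 - B)) :=
    ((((Commute.one_right B).sub_right (Commute.refl B)).cfcₙ_nnreal _).symm.cfcₙ_nnreal _).symm
  refine ⟨CFC.sqrt B, CFC.sqrt (1 - B), (CFC.sqrt_nonneg B).isSelfAdjoint,
    (CFC.sqrt_nonneg (1 - B)).isSelfAdjoint, hcomm, ?_, CFC.sqrt_mul_sqrt_self B, ?_⟩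
  · rw [← nonneg_iff_isPositive]
    exact hcomm.mul_nonneg (CFC.sqrt_nonneg B) (CFC.sqrt_nonneg (1 - B))
  · rw [CFC.sqrt_mul_sqrt_self B, CFC.sqrt_mul_sqrt_self (1 - B), add_sub_cancel]

namespace ContinuousLinearMap

variable {H : Type*} [NormedAddCommGroup H] [InnerProductSpace ℂ H]

/-- The unbounded operator `S C⁻¹` with domain `ran C`, sending `C x` to `S x`, for bounded
operators `S` and `C` with `C` injective. -/
noncomputable def mulInverse (S C : H →L[ℂ] H) (hC : Function.Injective C) : H →ₗ.[ℂ] H where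
  domain := LinearMap.range (C : H →ₗ[ℂ] H)
  toFun := (S : H →ₗ[ℂ] H) ∘ₗ
    (LinearEquiv.ofInjective (C : H →ₗ[ℂ] H) hC).symm.toLinearMap

theorem mulInverse_apply (S C : H →L[ℂ] H) (hC : Function.Injective C) (x : H)
    (h : C x ∈ (mulInverse S C hC).domain) : mulInverse S C hC ⟨C x, h⟩ = S x := by
  have : (LinearEquiv.ofInjective (C : H →ₗ[ℂ] H) hC).symm ⟨C x, h⟩ = x := by
    rw [LinearEquiv.symm_apply_eq]
    rfl
  exact congrArg S this

theorem inner_apply_comm [CompleteSpace H] {T : H →L[ℂ] H} (hT : IsSelfAdjoint T) (x y : H) :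
    inner ℂ (T x) y = inner ℂ x (T y) :=
  hT.isSymmetric x y

/-- The operator is symmetric because `C` and `S` commute, and the domain of its adjoint is no
larger: if `(u, z)` is in the graph of the adjoint, then `S u = C z`, and `C² + S² = 1` gives
`u = C (C u + S z)`. -/
theorem isPositiveSelfAdjoint_mulInverse [CompleteSpace H] {S C : H →L[ℂ] H}
    (hinj : Function.Injective C) (hC : IsSelfAdjoint C) (hS : IsSelfAdjoint S)
    (hcomm : Commute C S) (hpos : (C * S).IsPositive) (hsum : C * C + S * S = 1) :
    IsPositiveSelfAdjoint (mulInverse S C hinj) := by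
  have hdense : Dense ((mulInverse S C hinj).domain : Set H) := by
    refine Submodule.dense_iff_topologicalClosure_eq_top.2 ?_
    rw [Submodule.topologicalClosure_eq_top_iff]
    change (LinearMap.range (C : H →ₗ[ℂ] H))ᗮ = ⊥
    rw [orthogonal_range, hC.adjoint_eq]
    exact LinearMap.ker_eq_bot.2 hinj
  have hCS (x : H) : C (S x) = S (C x) := congrArg (· x) hcomm.eq
  have hsum' (x : H) : C (C x) + S (S x) = x := congrArg (· x) hsum
  have hmem (x : H) : C x ∈ (mulInverse S C hinj).domain := ⟨x, rfl⟩
  have hformal : (mulInverse S C hinj).IsFormalAdjoint (mulInverse S C hinj) := by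
    rintro ⟨_, x, rfl⟩ ⟨_, y, rfl⟩
    change inner ℂ (mulInverse S C hinj ⟨C x, hmem x⟩) (C y) =
      inner ℂ (C x) (mulInverse S C hinj ⟨C y, hmem y⟩)
    rw [mulInverse_apply, mulInverse_apply, inner_apply_comm hS, inner_apply_comm hC, hCS]
  refine ⟨hdense, ?_, ?_⟩
  · refine (LinearPMap.eq_of_le_of_domain_eq (hformal.le_adjoint hdense) ?_).symm
    refine le_antisymm (hformal.le_adjoint hdense).1 fun u hu => ?_
    set z := (mulInverse S C hinj).adjoint ⟨u, hu⟩
    -- Membership of `(u, z)` in the graph of the adjoint, tested against all `(C x, S x)`.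
    have hSu : S u = C z := by
      refine ext_inner_right ℂ fun x => ?_
      have := LinearPMap.adjoint_isFormalAdjoint hdense ⟨u, hu⟩ ⟨C x, hmem x⟩
      rw [mulInverse_apply] at this
      rw [inner_apply_comm hS, inner_apply_comm hC]
      exact this.symm
    refine ⟨C u + S z, ?_⟩
    change C (C u + S z) = u
    rw [map_add, hCS, ← hSu, hsum']
  · rintro ⟨_, x, rfl⟩
    change 0 ≤ (inner ℂ (C x) (mulInverse S C hinj ⟨C x, hmem x⟩)).re
    rw [mulInverse_apply, inner_apply_comm hC]
    exact hpos.re_inner_nonneg_right x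

end ContinuousLinearMap

open ContinuousLinearMap in
/-- If `D` is the graph of a closed operator `T` and `P` is its first projection, the right-hand
side is `⟨T (P d), T (P e)⟩`, so that `W` is the absolute value `|T|`. -/
theorem exists_isPositiveSelfAdjoint_of_contraction
    {H D : Type*} [NormedAddCommGroup H] [InnerProductSpace ℂ H] [CompleteSpace H]
    [NormedAddCommGroup D] [InnerProductSpace ℂ D] [CompleteSpace D]
    (P : D →L[ℂ] H) (hinj : Function.Injective P) (hdense : DenseRange P)
    (hnorm : ∀ d, ‖P d‖ ≤ ‖d‖) :
    ∃ W : H →ₗ.[ℂ] H, IsPositiveSelfAdjoint W ∧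
      W.domain = LinearMap.range (P : D →ₗ[ℂ] H) ∧
      ∀ (d e : D) (hd : P d ∈ W.domain) (he : P e ∈ W.domain),
        inner ℂ (W ⟨P d, hd⟩) (W ⟨P e, he⟩) = inner ℂ d e - inner ℂ (P d) (P e) := by
  have hP : ‖P‖ ≤ 1 := P.opNorm_le_bound zero_le_one (by simpa using hnorm)
  have hB : (P ∘L adjoint P).IsPositive := isPositive_self_comp_adjoint P
  have hB' : (1 - P ∘L adjoint P).IsPositive := by
    refine ⟨((IsSelfAdjoint.one _).sub hB.isSelfAdjoint).isSymmetric, fun x => ?_⟩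
    have hx : ‖adjoint P x‖ ≤ ‖x‖ := by
      refine ((adjoint P).le_of_opNorm_le ?_ x).trans_eq (one_mul _)
      rwa [LinearIsometryEquiv.norm_map]
    have h : inner ℂ ((1 - P ∘L adjoint P) x) x =
        inner ℂ x x - inner ℂ (adjoint P x) (adjoint P x) := by
      rw [adjoint_inner_right, ← inner_sub_left]
      rfl
    change 0 ≤ RCLike.re (inner ℂ ((1 - P ∘L adjoint P) x) x)
    rw [h, map_sub, ← norm_sq_eq_re_inner, ← norm_sq_eq_re_inner, sub_nonneg]
    gcongr
  obtain ⟨C, S, hC, hS, hcomm, hpos, hCC, hsum⟩ := exists_commuting_sqrt_pair hB hB'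
  have hCC' (x : H) : C (C x) = P (adjoint P x) := congrArg (· x) hCC
  have hnormC (x : H) : ‖adjoint P x‖ = ‖C x‖ := by
    rw [← sq_eq_sq₀ (norm_nonneg _) (norm_nonneg _), @norm_sq_eq_re_inner ℂ,
      @norm_sq_eq_re_inner ℂ, adjoint_inner_left, inner_apply_comm hC, hCC']
  have hCinj : Function.Injective C := by
    refine (injective_iff_map_eq_zero C).2 fun x hx => ?_
    have hx' : adjoint P x = 0 := by rw [← norm_eq_zero, hnormC, hx, norm_zero]
    refine hdense.eq_zero_of_inner_left ℂ fun d => ?_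
    rw [← adjoint_inner_left, hx', inner_zero_left]
  have hW := isPositiveSelfAdjoint_mulInverse hCinj hC hS hcomm hpos hsum
  have hCdense : DenseRange (C : H →ₗ[ℂ] H) := hW.dense_domain
  -- The unitary `V` of the polar decomposition `P* = V C`.
  let V : H →L[ℂ] D := ((adjoint P : H →L[ℂ] D) : H →ₗ[ℂ] D).extendOfNorm (C : H →ₗ[ℂ] H)
  have hVC (x : H) : V (C x) = adjoint P x :=
    LinearMap.extendOfNorm_eq hCdense ⟨1, fun x => by simpa using (hnormC x).le⟩ x
  have hPV : P ∘L V = C := by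
    refine ContinuousLinearMap.ext fun x => ?_
    refine congrFun (hCdense.equalizer (P ∘L V).continuous C.continuous (funext fun y => ?_)) x
    change P (V (C y)) = C (C y)
    rw [hVC, hCC']
  have hCV : C ∘L adjoint V = P := by
    have hVC' : V ∘L C = adjoint P := ContinuousLinearMap.ext hVC
    rw [← adjoint_adjoint P, ← hVC', adjoint_comp, hC.adjoint_eq]
  have hCV' (d : D) : C (adjoint V d) = P d := congrArg (· d) hCV
  have hVV (d : D) : V (adjoint V d) = d := by
    refine hinj ?_
    rw [← hCV' d]
    exact congrArg (· (adjoint V d)) hPV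
  refine ⟨mulInverse S C hCinj, hW, ?_, fun d e hd he => ?_⟩
  · refine le_antisymm ?_ ?_
    · rintro _ ⟨x, rfl⟩
      exact ⟨V x, congrArg (· x) hPV⟩
    · rintro _ ⟨d, rfl⟩
      exact ⟨adjoint V d, hCV' d⟩
  · have key (d : D) (hd : P d ∈ (mulInverse S C hCinj).domain) :
        mulInverse S C hCinj ⟨P d, hd⟩ = S (adjoint V d) := by
      simp only [← hCV' d]
      exact mulInverse_apply _ _ _ _ _
    have hSS : S (S (adjoint V e)) = adjoint V e - C (C (adjoint V e)) := by
      rw [eq_sub_iff_add_eq, add_comm]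
      exact congrArg (· (adjoint V e)) hsum
    rw [key, key, inner_apply_comm hS, hSS, inner_sub_right, ← inner_apply_comm hC, hCV', hCV',
      adjoint_inner_left, hVV]

/-! ### Sequences and the forms of represented functionals -/

theorem NonUnitalStarAlgHom.inner_map_star_left {A : Type*} [NonUnitalRing A] [StarRing A]
    [Module ℂ A] {H : Type*} [NormedAddCommGroup H] [InnerProductSpace ℂ H] [CompleteSpace H]
    (π : A →⋆ₙₐ[ℂ] (H →L[ℂ] H)) (a : A) (x y : H) :
    inner ℂ (π (star a) x) y = inner ℂ x (π a y) := by
  rw [map_star, ContinuousLinearMap.star_eq_adjoint, ContinuousLinearMap.adjoint_inner_left]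

namespace IsRepresentedBy

variable {A : Type*} [NonUnitalRing A] [StarRing A] [Module ℂ A]
  {H : Type*} [NormedAddCommGroup H] [InnerProductSpace ℂ H] [CompleteSpace H]
  {v : A →ₗ[ℂ] ℂ} {π : A →⋆ₙₐ[ℂ] (H →L[ℂ] H)} {ζ : H}

theorem apply_star_mul (hv : IsRepresentedBy v π ζ) (a b : A) :
    v (star b * a) = inner ℂ (π b ζ) (π a ζ) := by
  rw [hv.apply_eq, map_mul]
  change inner ℂ ζ (π (star b) (π a ζ)) = _
  rw [← NonUnitalStarAlgHom.inner_map_star_left π (star b), star_star]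

end IsRepresentedBy

section Sequences

variable {A : Type*} [NonUnitalRing A] [StarRing A] [Module ℂ A]
  {K : Type*} [NormedAddCommGroup K] [InnerProductSpace ℂ K]
  {v : A →ₗ[ℂ] ℂ} {f : A → K}

theorem tendsto_inner_self_zero_iff {ι : Type*} {l : Filter ι} {g : ι → K} :
    Tendsto (fun i => inner ℂ (g i) (g i)) l (𝓝 0) ↔ Tendsto g l (𝓝 0) := by
  rw [tendsto_zero_iff_norm_tendsto_zero, tendsto_zero_iff_norm_tendsto_zero (f := g)]
  have h (i : ι) : ‖inner ℂ (g i) (g i)‖ = ‖g i‖ ^ 2 := by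
    rw [inner_self_eq_norm_sq_to_K]
    simp
  simp only [h]
  refine ⟨fun hg => ?_, fun hg => by simpa using hg.pow 2⟩
  simpa using hg.sqrt

/-- Meant for two choices of `f`: the map `a ↦ π a ζ` of a cyclic representation, and
`a ↦ W (π a ζ)` for an operator `W` implementing the form. -/
theorem tendsto_apply_star_mul_self_iff (hf : ∀ a b, v (star b * a) = inner ℂ (f b) (f a))
    {ι : Type*} {l : Filter ι} {a : ι → A} :
    Tendsto (fun i => v (star (a i) * a i)) l (𝓝 0) ↔ Tendsto (fun i => f (a i)) l (𝓝 0) := by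
  simp only [hf, tendsto_inner_self_zero_iff]

theorem tendsto_apply_star_sub_mul_sub_iff (hf : ∀ a b, v (star b * a) = inner ℂ (f b) (f a))
    (hsub : ∀ a b, f (a - b) = f a - f b) {a : ℕ → A} :
    Tendsto (fun p : ℕ × ℕ => v ((star (a p.1) - star (a p.2)) * (a p.1 - a p.2)))
      (atTop ×ˢ atTop) (𝓝 0) ↔ CauchySeq fun n => f (a n) := by
  simp only [← star_sub, hf, tendsto_inner_self_zero_iff, hsub]
  rw [prod_atTop_atTop_eq, cauchySeq_iff_tendsto, uniformity_eq_comap_nhds_zero_swapped,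
    tendsto_comap_iff]
  rfl

end Sequences

/-! ### From an implementing operator to absolute continuity -/

section Implementation

variable {A : Type*} [NonUnitalRing A] [StarRing A] [Module ℂ A]
  {Hv : Type*} [NormedAddCommGroup Hv] [InnerProductSpace ℂ Hv] [CompleteSpace Hv]
  {v w : A →ₗ[ℂ] ℂ} {πv : A →⋆ₙₐ[ℂ] (Hv →L[ℂ] Hv)} {ζv : Hv}

theorem IsPositiveSelfAdjoint.isClosed {W : Hv →ₗ.[ℂ] Hv} (hW : IsPositiveSelfAdjoint W) :
    W.IsClosed :=
  IsSelfAdjoint.isClosed hW.adjoint_eq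

/-- Closedness of `W` forces the limit of `W πv(aₙ) ζv` to be `0` when `πv(aₙ) ζv → 0`. -/
theorem ImplementsForm.isAbsolutelyContinuous (hv : IsRepresentedBy v πv ζv) {W : Hv →ₗ.[ℂ] Hv}
    (hW : W.IsClosed) (hform : ImplementsForm πv ζv w W) : IsAbsolutelyContinuous w v := by
  obtain ⟨hdom, hform⟩ := hform
  let f : A → Hv := fun a => W ⟨πv a ζv, hdom a⟩
  have hsub (a b : A) : f (a - b) = f a - f b := by
    rw [← W.map_sub]
    refine congrArg W (Subtype.ext ?_)
    change πv (a - b) ζv = πv a ζv - πv b ζv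
    rw [map_sub, _root_.sub_apply]
  intro a ha hcauchy
  rw [tendsto_apply_star_mul_self_iff hv.apply_star_mul] at ha
  rw [tendsto_apply_star_sub_mul_sub_iff (f := f) hform hsub] at hcauchy
  rw [tendsto_apply_star_mul_self_iff (f := f) hform]
  obtain ⟨y, hy⟩ := cauchySeq_tendsto_of_complete hcauchy
  have hmem : ((0 : Hv), y) ∈ W.graph :=
    hW.mem_of_tendsto (ha.prodMk_nhds hy)
      (Eventually.of_forall fun n => W.mem_graph ⟨_, hdom (a n)⟩)
  rwa [W.graph_fst_eq_zero_snd hmem rfl] at hy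

end Implementation

/-! ### The closed graph and its modulus -/

section OrbitGraph

variable {A : Type*} [NonUnitalRing A] [StarRing A] [Module ℂ A]
  {Hv : Type*} [NormedAddCommGroup Hv] [InnerProductSpace ℂ Hv] [CompleteSpace Hv]
  {Hw : Type*} [NormedAddCommGroup Hw] [InnerProductSpace ℂ Hw] [CompleteSpace Hw]

/-- The linear map `a ↦ (πv a ζv, πw a ζw)`; its range is the graph of the relation
`πv a ζv ↦ πw a ζw` between the two representation spaces. -/
noncomputable def orbitPair (πv : A →⋆ₙₐ[ℂ] (Hv →L[ℂ] Hv)) (ζv : Hv)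
    (πw : A →⋆ₙₐ[ℂ] (Hw →L[ℂ] Hw)) (ζw : Hw) :
    A →ₗ[ℂ] WithLp 2 (Hv × Hw) where
  toFun a := WithLp.toLp 2 (πv a ζv, πw a ζw)
  map_add' a b := by simp [← WithLp.toLp_add]
  map_smul' c a := by simp [← WithLp.toLp_smul]

/-- The closure of the graph of `πv a ζv ↦ πw a ζw`, with the Hilbert space norm of
`Hv ⊕ Hw`. -/
noncomputable abbrev orbitGraph (πv : A →⋆ₙₐ[ℂ] (Hv →L[ℂ] Hv)) (ζv : Hv)
    (πw : A →⋆ₙₐ[ℂ] (Hw →L[ℂ] Hw)) (ζw : Hw) : Submodule ℂ (WithLp 2 (Hv × Hw)) :=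
  (LinearMap.range (orbitPair πv ζv πw ζw)).topologicalClosure

variable {v w : A →ₗ[ℂ] ℂ} {πv : A →⋆ₙₐ[ℂ] (Hv →L[ℂ] Hv)} {ζv : Hv}
  {πw : A →⋆ₙₐ[ℂ] (Hw →L[ℂ] Hw)} {ζw : Hw}

theorem orbitPair_mem_orbitGraph (a : A) :
    orbitPair πv ζv πw ζw a ∈ orbitGraph πv ζv πw ζw :=
  Submodule.le_topologicalClosure _ ⟨a, rfl⟩

/-- The graph is invariant under the direct sum representation `πv ⊕ πw`. -/
theorem orbitGraph_map_mem (a : A) {d : WithLp 2 (Hv × Hw)} (hd : d ∈ orbitGraph πv ζv πw ζw) :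
    WithLp.toLp 2 (πv a d.fst, πw a d.snd) ∈ orbitGraph πv ζv πw ζw := by
  have hcont : Continuous fun d : WithLp 2 (Hv × Hw) =>
      WithLp.toLp 2 (πv a d.fst, πw a d.snd) := by fun_prop
  refine map_mem_closure (f := fun d : WithLp 2 (Hv × Hw) =>
    WithLp.toLp 2 (πv a d.fst, πw a d.snd)) hcont hd ?_
  rintro _ ⟨b, rfl⟩
  refine ⟨a * b, ?_⟩
  change WithLp.toLp 2 (πv (a * b) ζv, πw (a * b) ζw) = _
  rw [map_mul, map_mul]
  rfl

/-- Absolute continuity makes the closure of `πv a ζv ↦ πw a ζw` single-valued. -/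
theorem IsAbsolutelyContinuous.injective_fst (hv : IsRepresentedBy v πv ζv)
    (hw : IsRepresentedBy w πw ζw) (hac : IsAbsolutelyContinuous w v) :
    Function.Injective (WithLp.fstL 2 ℂ Hv Hw ∘L (orbitGraph πv ζv πw ζw).subtypeL) := by
  refine (injective_iff_map_eq_zero _).2 ?_
  rintro ⟨d, hd⟩ hd0
  replace hd0 : d.fst = 0 := hd0
  obtain ⟨x, hx, hxd⟩ := mem_closure_iff_seq_limit.1 hd
  choose a ha using hx
  obtain rfl : (fun n => orbitPair πv ζv πw ζw (a n)) = x := funext ha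
  have hfst : Tendsto (fun n => πv (a n) ζv) atTop (𝓝 0) :=
    hd0 ▸ ((WithLp.fstL 2 ℂ Hv Hw).continuous.tendsto d).comp hxd
  have hsnd : Tendsto (fun n => πw (a n) ζw) atTop (𝓝 d.snd) :=
    ((WithLp.sndL 2 ℂ Hv Hw).continuous.tendsto d).comp hxd
  have h0 := hac a ((tendsto_apply_star_mul_self_iff hv.apply_star_mul).2 hfst)
    ((tendsto_apply_star_sub_mul_sub_iff hw.apply_star_mul (by simp)).2 hsnd.cauchySeq)
  rw [tendsto_apply_star_mul_self_iff hw.apply_star_mul] at h0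
  have hd1 : d.snd = 0 := tendsto_nhds_unique hsnd h0
  exact Subtype.ext ((WithLp.ofLp_injective 2) (Prod.ext hd0 hd1))

theorem IsAbsolutelyContinuous.exists_operator (hv : IsRepresentedBy v πv ζv)
    (hw : IsRepresentedBy w πw ζw) (hac : IsAbsolutelyContinuous w v) :
    ∃ W : Hv →ₗ.[ℂ] Hv, IsPositiveSelfAdjoint W ∧ ImplementsForm πv ζv w W ∧
      IntertwinesForm πv W := by
  let D := orbitGraph πv ζv πw ζw
  have : CompleteSpace D := (Submodule.isClosed_topologicalClosure _).completeSpace_coe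
  let P : D →L[ℂ] Hv := WithLp.fstL 2 ℂ Hv Hw ∘L D.subtypeL
  have hdense : DenseRange P :=
    hv.cyclic.mono (Set.range_subset_iff.2 fun a => ⟨⟨_, orbitPair_mem_orbitGraph a⟩, rfl⟩)
  obtain ⟨W, hW, hdom, hinner⟩ := exists_isPositiveSelfAdjoint_of_contraction P
    (hac.injective_fst hv hw) hdense fun d => WithLp.norm_fst_le Hv (d : WithLp 2 (Hv × Hw))
  have hmem (d : D) : P d ∈ W.domain := hdom ▸ ⟨d, rfl⟩
  have hinner' (d e : D) : inner ℂ (W ⟨P d, hmem d⟩) (W ⟨P e, hmem e⟩) =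
      inner ℂ (d : WithLp 2 (Hv × Hw)).snd (e : WithLp 2 (Hv × Hw)).snd := by
    rw [hinner, Submodule.coe_inner, WithLp.prod_inner_apply]
    exact add_sub_cancel_left _ _
  let L (a : A) (d : D) : D := ⟨_, orbitGraph_map_mem a d.2⟩
  refine ⟨W, hW, ⟨fun a => hmem ⟨_, orbitPair_mem_orbitGraph a⟩, fun a b => ?_⟩, ?_, ?_⟩
  · rw [hw.apply_star_mul]
    exact (hinner' ⟨_, orbitPair_mem_orbitGraph b⟩ ⟨_, orbitPair_mem_orbitGraph a⟩).symm
  · rintro a ⟨x, hx⟩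
    obtain ⟨d, rfl⟩ : ∃ d, P d = x := by rwa [hdom] at hx
    exact hmem (L a d)
  · rintro a ⟨x, hx⟩ ⟨y, hy⟩
    obtain ⟨d, rfl⟩ : ∃ d, P d = x := by rwa [hdom] at hx
    obtain ⟨e, rfl⟩ : ∃ e, P e = y := by rwa [hdom] at hy
    refine (hinner' e (L a d)).trans (Eq.trans ?_ (hinner' (L (star a) e) d).symm)
    exact (NonUnitalStarAlgHom.inner_map_star_left πw a _ _).symm

end OrbitGraph

theorem mainTheorem8
    {A : Type*} [NonUnitalRing A] [StarRing A] [Module ℂ A] [IsScalarTower ℂ A A]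
    [SMulCommClass ℂ A A] [StarModule ℂ A]
    {Hv : Type*} [NormedAddCommGroup Hv] [InnerProductSpace ℂ Hv] [CompleteSpace Hv]
    {Hw : Type*} [NormedAddCommGroup Hw] [InnerProductSpace ℂ Hw] [CompleteSpace Hw]
    (v w : A →ₗ[ℂ] ℂ)
    (πv : A →⋆ₙₐ[ℂ] (Hv →L[ℂ] Hv)) (ζv : Hv) (hv : IsRepresentedBy v πv ζv)
    (πw : A →⋆ₙₐ[ℂ] (Hw →L[ℂ] Hw)) (ζw : Hw) (hw : IsRepresentedBy w πw ζw) :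
    (IsAbsolutelyContinuous w v ↔
      ∃ W : Hv →ₗ.[ℂ] Hv, IsPositiveSelfAdjoint W ∧ ImplementsForm πv ζv w W) ∧
    (IsAbsolutelyContinuous w v ↔
      ∃ W : Hv →ₗ.[ℂ] Hv, IsPositiveSelfAdjoint W ∧ ImplementsForm πv ζv w W ∧
        IntertwinesForm πv W) := by
  refine ⟨⟨fun hac => ?_, fun ⟨W, hW, hform⟩ => hform.isAbsolutelyContinuous hv hW.isClosed⟩,
    ⟨fun hac => hac.exists_operator hv hw,
      fun ⟨W, hW, hform, _⟩ => hform.isAbsolutelyContinuous hv hW.isClosed⟩⟩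
  obtain ⟨W, hW, hform, -⟩ := hac.exists_operator hv hw
  exact ⟨W, hW, hform⟩
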